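/- Let $n\ge 1$, $0<\alpha<1$, let $\Omega\subset\mathbb{R}^n$ be a bounded convex domain and let $P\in\partial\Omega$ be fixed. For $Q\in\Omega$ put $r=|Q-P|$ and $\vec{\mathbf e}=(Q-P)/r$. For $f\in L_2(\Omega)$ (complex valued) and $\varepsilon>0$ let $$(\mathfrak D^{\alpha}_{0+,\varepsilon}f)(Q)=\frac{\alpha}{\Gamma(1-\alpha)}\int_0^{r-\varepsilon}\frac{f(Q)r^{n-1}-f(P+t\vec{\mathbf e})t^{n-1}}{(r-t)^{\alpha+1}r^{n-1}}\,dt+\frac{f(Q)}{\Gamma(1-\alpha)}r^{-\alpha}\quad\text{if } r\ge\varepsilon,$$ $$(\mathfrak D^{\alpha}_{0+,\varepsilon}f)(Q)=\frac{f(Q)}{\varepsilon^{\alpha}}\quad\text{if } r<\varepsilon,$$ and let the left-side directional fractional derivative $\mathfrak D^{\alpha}_{0+}f$ be the limit of $\mathfrak D^{\alpha}_{0+,\varepsilon}f$ in $L_2(\Omega)$ as $\varepsilon\to0+$, when this limit exists. Let $H^1_0(\Omega)$ be the closure of $C_0^\infty(\Omega)$ in the Sobolev space $H^1(\Omega)$,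 with the norm $\|f\|_{H^1_0}=\big(\sum_{i=1}^n\int_\Omega|D_if|^2\,dQ\big)^{1/2}$, where $D_i f$ are the generalized partial derivatives. Then there is a constant $\mathcal K>0$ such that, for every $f\in H^1_0(\Omega)$, the derivative $\mathfrak D^{\alpha}_{0+}f$ exists and $$\|\mathfrak D^{\alpha}_{0+}f\|_{L_2(\Omega)}\le\mathcal K\,\|f\|_{H^1_0(\Omega)}.$$ -/

import Mathlib

open MeasureTheory Filter Topology TopologicalSpace
open scoped ENNReal Distributions

noncomputable section

namespace Kipriyanov

/-- The `n`-dimensional Euclidean space. -/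
abbrev E (n : ℕ) : Type := EuclideanSpace ℝ (Fin n)

/-- The classical partial derivative `∂φ/∂xᵢ`. -/
def partialDeriv {n : ℕ} (i : Fin n) (φ : E n → ℂ) (x : E n) : ℂ :=
  fderiv ℝ φ x (EuclideanSpace.single i 1)

/-- `g` is a generalized (weak) derivative of `f` on `Ω` with respect to the `i`-th coordinate. -/
def HasWeakDeriv {n : ℕ} (Ω : Opens (E n)) (i : Fin n) (f g : E n → ℂ) : Prop :=
  LocallyIntegrableOn f (Ω : Set (E n)) ∧ LocallyIntegrableOn g (Ω : Set (E n)) ∧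
    ∀ φ : 𝓓(Ω, ℂ), ∫ x in (Ω : Set (E n)), f x * partialDeriv i φ x =
      -∫ x in (Ω : Set (E n)), g x * φ x

open Classical in
/-- The generalized derivative `Dᵢ f` on `Ω` (unique up to a null set of `Ω`; the value `0` is a
placeholder where none exists). -/
def weakDeriv {n : ℕ} (Ω : Opens (E n)) (i : Fin n) (f : E n → ℂ) : E n → ℂ :=
  if h : ∃ g, HasWeakDeriv Ω i f g then h.choose else 0

/-- `f` belongs to `H¹(Ω)`: it is square integrable together with its generalized first
derivatives, which exist. -/
def MemH1 {n : ℕ} (Ω : Opens (E n)) (f : E n → ℂ) : Prop :=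
  MemLp f 2 (volume.restrict (Ω : Set (E n))) ∧
    ∀ i, HasWeakDeriv Ω i f (weakDeriv Ω i f) ∧
      MemLp (weakDeriv Ω i f) 2 (volume.restrict (Ω : Set (E n)))

/-- `f` belongs to `H¹₀(Ω)`, the closure of `C₀^∞(Ω)` in `H¹(Ω)`. -/
def MemH10 {n : ℕ} (Ω : Opens (E n)) (f : E n → ℂ) : Prop :=
  MemH1 Ω f ∧ ∃ φ : ℕ → 𝓓(Ω, ℂ),
    Tendsto (fun k => eLpNorm (fun x => φ k x - f x) 2 (volume.restrict (Ω : Set (E n))))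
      atTop (𝓝 0) ∧
    ∀ i, Tendsto (fun k => eLpNorm (fun x => partialDeriv i (φ k) x - weakDeriv Ω i f x) 2
      (volume.restrict (Ω : Set (E n)))) atTop (𝓝 0)

/-- The norm `(∑ᵢ ∫_Ω |Dᵢ f|²)^{1/2}` of `H¹₀(Ω)`. -/
def normH10 {n : ℕ} (Ω : Opens (E n)) (f : E n → ℂ) : ℝ :=
  Real.sqrt (∑ i, ∫ x in (Ω : Set (E n)), ‖weakDeriv Ω i f x‖ ^ 2)

/-- The norm `(∫_Ω |g|²)^{1/2}` of `L₂(Ω)`. -/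
def normL2 {n : ℕ} (Ω : Opens (E n)) (g : E n → ℂ) : ℝ :=
  Real.sqrt (∫ x in (Ω : Set (E n)), ‖g x‖ ^ 2)

/-- The truncated left-side directional fractional derivative of order `α` with pole `P`. Here
`r = |P - Q|` and `e` is the unit vector pointing from `P` to `Q`. -/
def truncLeftDeriv {n : ℕ} (P : E n) (α ε : ℝ) (f : E n → ℂ) (Q : E n) : ℂ :=
  let r : ℝ := dist P Q
  let e : E n := r⁻¹ • (Q - P)
  if ε ≤ r then
    ((α / Real.Gamma (1 - α) : ℝ) : ℂ) *
        (∫ t in (0 : ℝ)..(r - ε),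
          (f Q * ((r ^ (n - 1) : ℝ) : ℂ) - f (P + t • e) * ((t ^ (n - 1) : ℝ) : ℂ)) /
            (((r - t) ^ (α + 1) * r ^ (n - 1) : ℝ) : ℂ)) +
      f Q / ((Real.Gamma (1 - α) : ℝ) : ℂ) * ((r ^ (-α) : ℝ) : ℂ)
  else
    f Q / ((ε ^ α : ℝ) : ℂ)

/-- `g` is the left-side directional fractional derivative of `f` on `Ω`: the truncated
derivatives of `f` converge to `g` in `L_p(Ω)` as `ε → 0+`. -/
def HasLeftDeriv {n : ℕ} (Ω : Opens (E n)) (P : E n) (α : ℝ) (p : ℝ≥0∞) (f g : E n → ℂ) : Prop :=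
  MemLp g p (volume.restrict (Ω : Set (E n))) ∧
  (∀ ε : ℝ, 0 < ε → MemLp (truncLeftDeriv P α ε f) p (volume.restrict (Ω : Set (E n)))) ∧
  Tendsto (fun ε : ℝ => eLpNorm (fun Q => truncLeftDeriv P α ε f Q - g Q) p
    (volume.restrict (Ω : Set (E n)))) (𝓝[>] 0) (𝓝 0)

open Classical in
/-- The left-side directional fractional derivative of `f` (unique up to a null set of `Ω`; the
value `0` is a placeholder where the limit does not exist). -/
def leftDeriv {n : ℕ} (Ω : Opens (E n)) (P : E n) (α : ℝ) (p : ℝ≥0∞) (f : E n → ℂ) : E n → ℂ :=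
  if h : ∃ g, HasLeftDeriv Ω P α p f g then h.choose else 0

end Kipriyanov

end

namespace Kipriyanov

variable {n : ℕ}

/-! The substitution t = rs turns the truncated derivative into r^(-α) times an integral over 0 < s
< 1 - ε/r of (f(Q) - s^(n-1) f(P + s(Q-P))) (1-s)^(-α-1), plus a multiple of r^(-α) f(Q). Hence all
truncations are dominated, uniformly in ε, by one function (`leftDerivMajorant`) built from
r^(-α)|f| and the absolute integral over 0 < s < 1. If this function is in L₂, dominated convergence
yields the derivative and its norm bound together (`hasLeftDeriv_of_majorant`,
`HasLeftDeriv.eLpNorm_le`).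

The L₂ bound by the Dirichlet integral is first proved for smooth functions vanishing off Ω
(`exists_energy_bound`). As Ω is bounded, r^(-α)|f| is at most a constant times |f|/r, which Hardy's
inequality controls (`exists_hardy_const`): convexity gives a hyperplane through P that misses Ω,
and f vanishes there. This works in every dimension. The integrand splits as (1 - s^(n-1)) f(Q) +
s^(n-1) (f(Q) - f(P + s(Q-P))). Each part gains a factor 1-s, by Bernoulli's inequality and by
integrating the gradient along the ray, so Minkowski's inequality leaves the integrable weight
s^(-1/2) (1-s)^(-α).

Almost everywhere convergence of a subsequence of test functions, together with Fatou's lemma,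
carries the bounds to H¹₀ (`MemH10.exists_representative`). -/

/-! ### Linear changes of variables and Minkowski's inequality in L². -/

theorem lintegral_comp_linearMap_sub (T : E n →ₗ[ℝ] E n) (hT : LinearMap.det T ≠ 0) (P : E n)
    {g : E n → ℝ≥0∞} (hg : Measurable g) :
    ∫⁻ x, g (P + T (x - P)) = ENNReal.ofReal |(LinearMap.det T)⁻¹| * ∫⁻ x, g x := by
  have hTm : Measurable T := T.continuous_of_finiteDimensional.measurable
  have hg' : Measurable fun y => g (P + y) := hg.comp (measurable_const_add P)
  calc ∫⁻ x, g (P + T (x - P)) = ∫⁻ x, g (P + T x) :=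
        lintegral_sub_right_eq_self (fun x => g (P + T x)) P
    _ = ∫⁻ y, g (P + y) ∂(Measure.map T volume) := (lintegral_map hg' hTm).symm
    _ = ENNReal.ofReal |(LinearMap.det T)⁻¹| * ∫⁻ y, g (P + y) := by
        rw [Measure.map_linearMap_addHaar_eq_smul_addHaar volume hT, lintegral_smul_measure,
          smul_eq_mul]
    _ = _ := by rw [lintegral_add_left_eq_self g P]

theorem ae_comp_linearMap_sub (T : E n →ₗ[ℝ] E n) (hT : LinearMap.det T ≠ 0) (P : E n)
    {p : E n → Prop} (hp : ∀ᵐ x, p x) : ∀ᵐ x, p (P + T (x - P)) := by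
  have hTm : Measurable T := T.continuous_of_finiteDimensional.measurable
  obtain ⟨N, hpN, hN, hN0⟩ := exists_measurable_superset_of_null (ae_iff.1 hp)
  have hg : Measurable (N.indicator (fun _ => (1 : ℝ≥0∞))) := measurable_const.indicator hN
  have h := lintegral_comp_linearMap_sub T hT P hg
  have hT : Measurable fun x => P + T (x - P) :=
    (hTm.comp (measurable_id.sub_const P)).const_add P
  rw [lintegral_indicator hN, setLIntegral_const, hN0, mul_zero, mul_zero] at h
  replace h := (lintegral_eq_zero_iff (hg.comp hT)).1 h
  filter_upwards [h] with x hx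
  by_contra hpx
  have := hpN hpx
  simp only [Function.comp_apply, Set.indicator_of_mem this, Pi.zero_apply, one_ne_zero] at hx

theorem sq_lintegral_mul_le {β : Type*} [MeasurableSpace β] {ν : Measure β} {f g : β → ℝ≥0∞}
    (hf : Measurable f) (hg : Measurable g) :
    (∫⁻ b, f b * g b ∂ν) ^ 2 ≤ (∫⁻ b, f b ^ 2 ∂ν) * ∫⁻ b, g b ^ 2 ∂ν := by
  have h := ENNReal.lintegral_mul_le_Lp_mul_Lq ν Real.HolderConjugate.two_two hf.aemeasurable
    hg.aemeasurable
  have key : ∀ a : ℝ≥0∞, (a ^ (1 / 2 : ℝ)) ^ 2 = a := fun a => by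
    rw [← ENNReal.rpow_natCast, ← ENNReal.rpow_mul]; norm_num
  calc _ ≤ _ := pow_le_pow_left' h 2
    _ = _ := by rw [mul_pow, key, key]; simp

/-- A form of Minkowski's integral inequality in `L²`: if the slices `g · b` have norm at most
`√C * w b`, then `∫ g · b` has norm at most `√C * ∫ w`. -/
theorem lintegral_sq_lintegral_le {α β : Type*} [MeasurableSpace α] [MeasurableSpace β]
    {μ : Measure α} {ν : Measure β} [SFinite μ] [SFinite ν] {g : α → β → ℝ≥0∞}
    (hg : Measurable (Function.uncurry g)) {w : β → ℝ≥0∞} (hw : Measurable w)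
    (hw0 : ∀ᵐ b ∂ν, w b ≠ 0) (hwt : ∀ᵐ b ∂ν, w b ≠ ∞) {C : ℝ≥0∞}
    (h : ∀ᵐ b ∂ν, ∫⁻ a, g a b ^ 2 ∂μ ≤ C * w b ^ 2) :
    ∫⁻ a, (∫⁻ b, g a b ∂ν) ^ 2 ∂μ ≤ C * (∫⁻ b, w b ∂ν) ^ 2 := by
  have hgb : ∀ a, Measurable (g a) := fun a => hg.comp measurable_prodMk_left
  have hga : ∀ b, Measurable (fun a => g a b) := fun b => hg.comp measurable_prodMk_right
  have hm : Measurable (Function.uncurry fun a b => g a b ^ 2 * (w b)⁻¹) :=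
    (hg.pow_const 2).mul (hw.comp measurable_snd).inv
  -- Cauchy–Schwarz for the splitting g = w^(1/2) · (g w^(-1/2)); Tonelli then reduces the claim to
  -- the slice bounds.
  have cs : ∀ a, (∫⁻ b, g a b ∂ν) ^ 2 ≤ (∫⁻ b, w b ∂ν) * ∫⁻ b, g a b ^ 2 * (w b)⁻¹ ∂ν := by
    intro a
    have h1 : ∫⁻ b, g a b ∂ν
        = ∫⁻ b, (w b ^ (1 / 2 : ℝ)) * (g a b * (w b)⁻¹ ^ (1 / 2 : ℝ)) ∂ν := by
      refine lintegral_congr_ae ?_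
      filter_upwards [hw0, hwt] with b h0 ht
      rw [mul_left_comm, ← ENNReal.mul_rpow_of_nonneg _ _ (by norm_num : (0 : ℝ) ≤ 1 / 2),
        ENNReal.mul_inv_cancel h0 ht]
      simp
    have key : ∀ a : ℝ≥0∞, (a ^ (1 / 2 : ℝ)) ^ 2 = a := fun a => by
      rw [← ENNReal.rpow_natCast, ← ENNReal.rpow_mul]; norm_num
    rw [h1]
    refine (sq_lintegral_mul_le (hw.pow_const _) ((hgb a).mul (hw.inv.pow_const _))).trans
      (le_of_eq ?_)
    simp only [Pi.mul_apply, Pi.inv_apply, mul_pow, key]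
  calc ∫⁻ a, (∫⁻ b, g a b ∂ν) ^ 2 ∂μ
      ≤ ∫⁻ a, (∫⁻ b, w b ∂ν) * ∫⁻ b, g a b ^ 2 * (w b)⁻¹ ∂ν ∂μ := lintegral_mono cs
    _ = (∫⁻ b, w b ∂ν) * ∫⁻ b, ∫⁻ a, g a b ^ 2 * (w b)⁻¹ ∂μ ∂ν := by
        rw [lintegral_const_mul _ hm.lintegral_prod_right, lintegral_lintegral_swap hm.aemeasurable]
    _ ≤ (∫⁻ b, w b ∂ν) * ∫⁻ b, C * w b ∂ν := by
        gcongr 1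
        refine lintegral_mono_ae ?_
        filter_upwards [h, hw0, hwt] with b hb h0 ht
        rw [lintegral_mul_const _ ((hga b).pow_const 2)]
        calc _ ≤ C * w b ^ 2 * (w b)⁻¹ := by gcongr
          _ = C * w b := by rw [pow_two, mul_assoc, mul_assoc, ENNReal.mul_inv_cancel h0 ht, mul_one]
    _ = C * (∫⁻ b, w b ∂ν) ^ 2 := by rw [lintegral_const_mul _ hw]; ring

/-- The change of variables gives each slice the L² norm d(t)⁻¹ ‖g‖, and Minkowski's inequality adds
these up. Writing the determinant as a square keeps roots out of the statement. -/
theorem lintegral_sq_lintegral_comp_linear_le (A : ℝ → E n →ₗ[ℝ] E n)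
    (hA : Continuous fun p : E n × ℝ => A p.2 p.1) {a b : ℝ} {d : ℝ → ℝ} (hdm : Measurable d)
    (hd0 : ∀ t ∈ Set.Ioo a b, 0 < d t) (hd : ∀ t ∈ Set.Ioo a b, LinearMap.det (A t) = d t ^ 2)
    (P : E n) {g : E n → ℝ≥0∞} (hg : Measurable g) :
    ∫⁻ x, (∫⁻ t in Set.Ioo a b, g (P + A t (x - P))) ^ 2 ≤
      (∫⁻ x, g x ^ 2) * (∫⁻ t in Set.Ioo a b, ENNReal.ofReal (d t)⁻¹) ^ 2 := by
  have hc : Continuous fun p : E n × ℝ => P + A p.2 (p.1 - P) :=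
    continuous_const.add (hA.comp (f := fun p : E n × ℝ => (p.1 - P, p.2)) (by fun_prop))
  have hae : ∀ᵐ t ∂(volume.restrict (Set.Ioo a b)), t ∈ Set.Ioo a b :=
    ae_restrict_mem measurableSet_Ioo
  refine lintegral_sq_lintegral_le (g := fun x t => g (P + A t (x - P))) (hg.comp hc.measurable)
    (by fun_prop) ?_ ?_ ?_
  · filter_upwards [hae] with t ht
    simpa using hd0 t ht
  · exact Eventually.of_forall fun t => ENNReal.ofReal_ne_top
  · filter_upwards [hae] with t ht
    have h0 := hd0 t ht
    rw [lintegral_comp_linearMap_sub (A t) (by rw [hd t ht]; positivity) P (hg.pow_const 2), hd t ht,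
      mul_comm, ← ENNReal.ofReal_pow (by positivity), inv_pow, abs_of_pos (by positivity)]

/-! ### Increments along segments and Hardy's inequality. -/

theorem enorm_sub_le_lintegral_fderiv {φ : E n → ℂ} (hφ : ContDiff ℝ 1 φ) (x v : E n) {s : ℝ}
    (hs : s ≤ 1) :
    ‖φ x - φ (x - (1 - s) • v)‖ₑ ≤
      ‖v‖ₑ * ∫⁻ t in Set.Ioo s 1, ‖fderiv ℝ φ (x - (1 - t) • v)‖ₑ := by
  have hc : Continuous fun t : ℝ => x - (1 - t) • v := by fun_prop
  have hf : Continuous fun t : ℝ => fderiv ℝ φ (x - (1 - t) • v) :=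
    (hφ.continuous_fderiv one_ne_zero).comp hc
  have hderiv : ∀ t ∈ Set.uIcc s 1, HasDerivAt (fun t : ℝ => φ (x - (1 - t) • v))
      (fderiv ℝ φ (x - (1 - t) • v) v) t := by
    intro t _
    have h1 : HasDerivAt (fun t : ℝ => x - (1 - t) • v) v t := by
      simpa using (((hasDerivAt_id t).const_sub 1).smul_const v).const_sub x
    exact ((hφ.differentiable one_ne_zero _).hasFDerivAt).comp_hasDerivAt t h1
  have h := intervalIntegral.integral_eq_sub_of_hasDerivAt hderiv
    ((hf.clm_apply continuous_const).intervalIntegrable _ _)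
  simp only [sub_self, zero_smul, sub_zero] at h
  rw [← h, intervalIntegral.integral_of_le hs, integral_Ioc_eq_integral_Ioo,
    ← lintegral_const_mul _ hf.measurable.enorm]
  refine (enorm_integral_le_lintegral_enorm _).trans (lintegral_mono fun t => ?_)
  rw [mul_comm]
  exact ContinuousLinearMap.le_opENorm _ _

/-- This is a Beta integral, finite because the Beta density has total mass one. -/
theorem lintegral_rpow_mul_one_sub_rpow_ne_top {a b : ℝ} (ha : -1 < a) (hb : -1 < b) :
    ∫⁻ t in Set.Ioo (0 : ℝ) 1, ENNReal.ofReal (t ^ a * (1 - t) ^ b) ≠ ∞ := by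
  have ha' : 0 < a + 1 := by linarith
  have hb' : 0 < b + 1 := by linarith
  have h0 := ProbabilityTheory.beta_pos ha' hb'
  have h := ProbabilityTheory.lintegral_betaPDF_eq_one ha' hb'
  rw [ProbabilityTheory.lintegral_betaPDF] at h
  have h2 : ∫⁻ t in Set.Ioo (0 : ℝ) 1, ENNReal.ofReal (t ^ a * (1 - t) ^ b) =
      ENNReal.ofReal (ProbabilityTheory.beta (a + 1) (b + 1)) * 1 := by
    rw [← h, ← lintegral_const_mul _ (by fun_prop)]
    refine lintegral_congr fun t => ?_
    rw [← ENNReal.ofReal_mul h0.le]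
    congr 1
    simp only [add_sub_cancel_right]
    field_simp
  rw [h2, mul_one]
  exact ENNReal.ofReal_ne_top

/-- The Dirichlet integral `∫ |∇φ|²` over the whole space. -/
noncomputable def energy (φ : E n → ℂ) : ℝ≥0∞ := ∫⁻ x, ‖fderiv ℝ φ x‖ₑ ^ 2

/-- Hardy's inequality for functions vanishing outside an open convex set, with respect to a
point that does not belong to the set. -/
theorem exists_hardy_const (Ω : Opens (E n)) (hΩ : Convex ℝ (Ω : Set (E n)))
    (hne : (Ω : Set (E n)).Nonempty) {P : E n} (hP : P ∉ Ω) :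
    ∃ C : ℝ≥0∞, C ≠ ∞ ∧ ∀ φ : E n → ℂ, ContDiff ℝ 1 φ → (∀ x ∉ Ω, φ x = 0) →
      ∫⁻ x in (Ω : Set (E n)), (‖x - P‖ₑ⁻¹ * ‖φ x‖ₑ) ^ 2 ≤ C * energy φ := by
  obtain ⟨l, hl⟩ := geometric_hahn_banach_open_point hΩ Ω.isOpen hP
  obtain ⟨a, ha⟩ := hne
  have hla : l (a - P) ≠ 0 := by rw [map_sub]; exact (sub_neg.2 (hl a ha)).ne
  set v : E n := (l (a - P))⁻¹ • (a - P) with hv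
  have hlv : l v = 1 := by rw [hv, map_smul, smul_eq_mul, inv_mul_cancel₀ hla]
  -- `A t` fixes the kernel of `l` and contracts the direction `v` by the factor t, so its
  -- determinant is t and the slice norms t^(-1/2) are integrable.
  let A : ℝ → E n →ₗ[ℝ] E n := fun t => LinearMap.transvection ((t - 1) • l.toLinearMap) v
  have hA : ∀ t x, A t x = x - (1 - t) • (l x • v) := fun t x => by
    simp only [A, LinearMap.transvection.apply, LinearMap.smul_apply, smul_smul]
    rw [show t - 1 = -(1 - t) by ring, smul_eq_mul, neg_mul, neg_smul, ← sub_eq_add_neg]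
    rfl
  have hAc : Continuous fun p : E n × ℝ => A p.2 p.1 := by
    simp only [hA]; fun_prop
  have hdet : ∀ t ∈ Set.Ioo (0 : ℝ) 1, LinearMap.det (A t) = (t ^ (1 / 2 : ℝ)) ^ 2 := by
    intro t ht
    rw [← Real.rpow_natCast, ← Real.rpow_mul ht.1.le]
    simp [A, LinearMap.transvection.det, hlv]
  set I : ℝ≥0∞ := ∫⁻ t in Set.Ioo (0 : ℝ) 1, ENNReal.ofReal (t ^ (1 / 2 : ℝ))⁻¹ with hI
  have hIt : I ≠ ∞ := by
    have := lintegral_rpow_mul_one_sub_rpow_ne_top (a := -(1 / 2)) (b := 0) (by norm_num)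
      (by norm_num)
    convert! this using 1
    refine setLIntegral_congr_fun measurableSet_Ioo fun t ht => ?_
    simp only [Real.rpow_zero, mul_one, Real.rpow_neg ht.1.le]
  refine ⟨(‖l‖ₑ * ‖v‖ₑ) ^ 2 * I ^ 2, by finiteness, fun φ hφ hφ0 => ?_⟩
  have hm : Measurable fun x => ‖fderiv ℝ φ x‖ₑ :=
    (hφ.continuous_fderiv one_ne_zero).measurable.enorm
  have hpt : ∀ x ∈ (Ω : Set (E n)), (‖x - P‖ₑ⁻¹ * ‖φ x‖ₑ) ^ 2 ≤ (‖l‖ₑ * ‖v‖ₑ) ^ 2 *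
      (∫⁻ t in Set.Ioo (0 : ℝ) 1, ‖fderiv ℝ φ (P + A t (x - P))‖ₑ) ^ 2 := by
    intro x hx
    have hxP : x - P ≠ 0 := sub_ne_zero.2 fun h => hP (h ▸ hx)
    rw [← mul_pow]
    refine pow_le_pow_left' ?_ 2
    have h1 := enorm_sub_le_lintegral_fderiv hφ x (l (x - P) • v) zero_le_one
    rw [hφ0 (x - (1 - 0 : ℝ) • (l (x - P) • v)), sub_zero] at h1
    · rw [mul_comm, ← div_eq_mul_inv]
      refine ENNReal.div_le_of_le_mul (h1.trans ?_)
      rw [enorm_smul]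
      have h2 := l.le_opENorm (x - P)
      have h3 : ∀ t, P + A t (x - P) = x - (1 - t) • (l (x - P) • v) := fun t => by
        rw [hA]; abel
      simp only [h3]
      calc _ ≤ ‖l‖ₑ * ‖x - P‖ₑ * ‖v‖ₑ * _ := by gcongr
        _ = _ := by ring
    -- The endpoint t = 0 lies on the hyperplane where `l` equals `l P`, whereas `l` is strictly
    -- smaller on Ω.
    · intro hmem
      have := hl _ hmem
      simp [hlv] at this
  calc _ ≤ ∫⁻ x in (Ω : Set (E n)), (‖l‖ₑ * ‖v‖ₑ) ^ 2 *
      (∫⁻ t in Set.Ioo (0 : ℝ) 1, ‖fderiv ℝ φ (P + A t (x - P))‖ₑ) ^ 2 :=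
        setLIntegral_mono' Ω.isOpen.measurableSet hpt
    _ ≤ ∫⁻ x, (‖l‖ₑ * ‖v‖ₑ) ^ 2 *
      (∫⁻ t in Set.Ioo (0 : ℝ) 1, ‖fderiv ℝ φ (P + A t (x - P))‖ₑ) ^ 2 :=
        setLIntegral_le_lintegral _ _
    _ = (‖l‖ₑ * ‖v‖ₑ) ^ 2 * ∫⁻ x,
      (∫⁻ t in Set.Ioo (0 : ℝ) 1, ‖fderiv ℝ φ (P + A t (x - P))‖ₑ) ^ 2 :=
        lintegral_const_mul' _ _ (by finiteness)
    _ ≤ (‖l‖ₑ * ‖v‖ₑ) ^ 2 * (energy φ * I ^ 2) := by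
        gcongr
        exact lintegral_sq_lintegral_comp_linear_le A hAc (by fun_prop)
          (fun t ht => Real.rpow_pos_of_pos ht.1 _) hdet P hm
    _ = _ := by ring

/-- The increment is integrated along the ray from P. The homothety of ratio t has determinant t^n,
so its slice norm t^(-n/2) is at most s^(-n/2) on (s, 1); the segment length contributes a factor r,
and r^(1-α) ≤ D^(1-α). -/
theorem lintegral_sq_enorm_sub_homothety_le {φ : E n → ℂ} (hφ : ContDiff ℝ 1 φ) (P : E n)
    {Ω : Set (E n)} (hΩ : MeasurableSet Ω) {α D : ℝ} (hα : α < 1)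
    (hD : ∀ x ∈ Ω, dist P x ≤ D) (hP : P ∉ Ω) {s : ℝ} (hs : s ∈ Set.Ioo (0 : ℝ) 1) :
    ∫⁻ x in Ω, (ENNReal.ofReal (dist P x ^ (-α)) * ‖φ x - φ (P + s • (x - P))‖ₑ) ^ 2 ≤
      ENNReal.ofReal (D ^ (1 - α)) ^ 2 * energy φ *
        ENNReal.ofReal (s ^ (-(n / 2 : ℝ)) * (1 - s)) ^ 2 := by
  let A : ℝ → E n →ₗ[ℝ] E n := fun t => t • LinearMap.id
  have hAc : Continuous fun p : E n × ℝ => A p.2 p.1 := by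
    simp only [A, LinearMap.smul_apply, LinearMap.id_apply]; fun_prop
  have hdet : ∀ t ∈ Set.Ioo s 1, LinearMap.det (A t) = (t ^ (n / 2 : ℝ)) ^ 2 := by
    intro t ht
    rw [← Real.rpow_natCast, ← Real.rpow_mul (hs.1.trans ht.1).le]
    simp [A]
  have hm : Measurable fun x => ‖fderiv ℝ φ x‖ₑ :=
    (hφ.continuous_fderiv one_ne_zero).measurable.enorm
  have hI : ∫⁻ t in Set.Ioo s 1, ENNReal.ofReal (t ^ (n / 2 : ℝ))⁻¹ ≤
      ENNReal.ofReal (s ^ (-(n / 2 : ℝ)) * (1 - s)) := by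
    calc _ ≤ ∫⁻ t in Set.Ioo s 1, ENNReal.ofReal (s ^ (-(n / 2 : ℝ))) := by
          refine setLIntegral_mono' measurableSet_Ioo fun t ht => ENNReal.ofReal_le_ofReal ?_
          rw [Real.rpow_neg hs.1.le]
          have := Real.rpow_pos_of_pos hs.1 (n / 2 : ℝ)
          gcongr
          · exact hs.1.le
          · exact ht.1.le
      _ = _ := by
          rw [setLIntegral_const, Real.volume_Ioo, ENNReal.ofReal_mul (Real.rpow_nonneg hs.1.le _)]
  have hpt : ∀ x ∈ Ω, (ENNReal.ofReal (dist P x ^ (-α)) * ‖φ x - φ (P + s • (x - P))‖ₑ) ^ 2 ≤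
      ENNReal.ofReal (D ^ (1 - α)) ^ 2 *
      (∫⁻ t in Set.Ioo s 1, ‖fderiv ℝ φ (P + A t (x - P))‖ₑ) ^ 2 := by
    intro x hx
    have hr : 0 < dist P x := dist_pos.2 fun h => hP (h ▸ hx)
    rw [← mul_pow]
    refine pow_le_pow_left' ?_ 2
    have h1 := enorm_sub_le_lintegral_fderiv hφ x (x - P) hs.2.le
    have h3 : ∀ t : ℝ, x - (1 - t) • (x - P) = P + t • (x - P) := fun t => by module
    simp only [h3] at h1
    calc _ ≤ ENNReal.ofReal (dist P x ^ (-α)) * (‖x - P‖ₑ *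
          ∫⁻ t in Set.Ioo s 1, ‖fderiv ℝ φ (P + t • (x - P))‖ₑ) := by gcongr
      _ = ENNReal.ofReal (dist P x ^ (1 - α)) *
          ∫⁻ t in Set.Ioo s 1, ‖fderiv ℝ φ (P + t • (x - P))‖ₑ := by
          rw [← mul_assoc, ← ofReal_norm, ← dist_eq_norm, dist_comm x P,
            ← ENNReal.ofReal_mul (by positivity), ← Real.rpow_add_one hr.ne']
          congr 3; ring
      _ ≤ _ := mul_le_mul' (ENNReal.ofReal_le_ofReal
          (Real.rpow_le_rpow dist_nonneg (hD x hx) (by linarith))) le_rfl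
  calc _ ≤ ∫⁻ x in Ω, ENNReal.ofReal (D ^ (1 - α)) ^ 2 *
      (∫⁻ t in Set.Ioo s 1, ‖fderiv ℝ φ (P + A t (x - P))‖ₑ) ^ 2 :=
        setLIntegral_mono' hΩ hpt
    _ ≤ ∫⁻ x, ENNReal.ofReal (D ^ (1 - α)) ^ 2 *
      (∫⁻ t in Set.Ioo s 1, ‖fderiv ℝ φ (P + A t (x - P))‖ₑ) ^ 2 :=
        setLIntegral_le_lintegral _ _
    _ = ENNReal.ofReal (D ^ (1 - α)) ^ 2 * ∫⁻ x,
      (∫⁻ t in Set.Ioo s 1, ‖fderiv ℝ φ (P + A t (x - P))‖ₑ) ^ 2 :=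
        lintegral_const_mul' _ _ (by finiteness)
    _ ≤ ENNReal.ofReal (D ^ (1 - α)) ^ 2 *
        (energy φ * ENNReal.ofReal (s ^ (-(n / 2 : ℝ)) * (1 - s)) ^ 2) := by
        gcongr
        refine (lintegral_sq_lintegral_comp_linear_le A hAc (by fun_prop)
          (fun t ht => Real.rpow_pos_of_pos (hs.1.trans ht.1) _) hdet P hm).trans ?_
        gcongr
        exact le_rfl
    _ = _ := by ring

/-! ### The rescaled integrand and its energy bound. -/

/-- The integrand of the fractional derivative in the variable `s = t / r`, up to the factor
`r ^ (-α)`. -/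
noncomputable def marchaudIntegrand (P : E n) (α : ℝ) (f : E n → ℂ) (x : E n) (s : ℝ) : ℂ :=
  (f x - ((s ^ (n - 1) : ℝ) : ℂ) * f (P + s • (x - P))) * (((1 - s) ^ (-(α + 1)) : ℝ) : ℂ)

/-- The function `r ^ (-α) |f|`. -/
noncomputable def radialWeight (P : E n) (α : ℝ) (f : E n → ℂ) (x : E n) : ℝ≥0∞ :=
  ENNReal.ofReal (dist P x ^ (-α)) * ‖f x‖ₑ

/-- The integral of the absolute value of the integrand of the fractional derivative. -/
noncomputable def marchaudMajorant (P : E n) (α : ℝ) (f : E n → ℂ) (x : E n) : ℝ≥0∞ :=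
  ∫⁻ s in Set.Ioo (0 : ℝ) 1, ENNReal.ofReal (dist P x ^ (-α)) * ‖marchaudIntegrand P α f x s‖ₑ

theorem measurable_marchaudIntegrand (P : E n) (α : ℝ) {f : E n → ℂ} (hf : Measurable f) :
    Measurable (Function.uncurry (marchaudIntegrand P α f)) := by
  have h1 : Measurable fun p : E n × ℝ => f (P + p.2 • (p.1 - P)) := hf.comp (by fun_prop)
  unfold Function.uncurry marchaudIntegrand
  fun_prop

theorem measurable_radialWeight (P : E n) (α : ℝ) {f : E n → ℂ} (hf : Measurable f) :
    Measurable (radialWeight P α f) := by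
  unfold radialWeight
  fun_prop

theorem measurable_weighted_marchaudIntegrand (P : E n) (α : ℝ) {f : E n → ℂ}
    (hf : Measurable f) : Measurable (Function.uncurry fun x s =>
      ENNReal.ofReal (dist P x ^ (-α)) * ‖marchaudIntegrand P α f x s‖ₑ) := by
  have h1 := (measurable_marchaudIntegrand P α hf).enorm
  have h2 : Measurable fun p : E n × ℝ => ENNReal.ofReal (dist P p.1 ^ (-α)) := by fun_prop
  exact h2.mul h1

theorem measurable_marchaudMajorant (P : E n) (α : ℝ) {f : E n → ℂ} (hf : Measurable f) :
    Measurable (marchaudMajorant P α f) :=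
  (measurable_weighted_marchaudIntegrand P α hf).lintegral_prod_right

theorem add_sq_le_two_mul (a b : ℝ≥0∞) : (a + b) ^ 2 ≤ 2 * (a ^ 2 + b ^ 2) := by
  have := ENNReal.rpow_add_le_mul_rpow_add_rpow a b (p := 2) (by norm_num)
  norm_num at this
  exact_mod_cast this

/-- The defect of the factor s^(n-1) from 1 is separated from the increment of f; Bernoulli's
inequality makes the former O(1-s), which cancels one power of the singularity. -/
theorem weighted_marchaudIntegrand_le (P : E n) (α : ℝ) (f : E n → ℂ) (x : E n) {s : ℝ}
    (hs : s ∈ Set.Ioo (0 : ℝ) 1) :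
    ENNReal.ofReal (dist P x ^ (-α)) * ‖marchaudIntegrand P α f x s‖ₑ ≤
      n * ENNReal.ofReal (s ^ (-(1 / 2) : ℝ) * (1 - s) ^ (-α)) * radialWeight P α f x +
      ENNReal.ofReal (s ^ (n - 1) * (1 - s) ^ (-(α + 1))) *
        (ENNReal.ofReal (dist P x ^ (-α)) * ‖f x - f (P + s • (x - P))‖ₑ) := by
  obtain ⟨h0, h1⟩ := hs
  have h1' : 0 < 1 - s := sub_pos.2 h1
  have hsplit : marchaudIntegrand P α f x s =
      (((1 - s ^ (n - 1)) * (1 - s) ^ (-(α + 1)) : ℝ) : ℂ) * f x +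
      ((s ^ (n - 1) * (1 - s) ^ (-(α + 1)) : ℝ) : ℂ) * (f x - f (P + s • (x - P))) := by
    simp only [marchaudIntegrand]; push_cast; ring
  have hpow : s ^ (n - 1) ≤ 1 := pow_le_one₀ h0.le h1.le
  have hrp : 0 < (1 - s) ^ (-(α + 1)) := Real.rpow_pos_of_pos h1' _
  have hbern : (1 - s ^ (n - 1)) * (1 - s) ^ (-(α + 1)) ≤
      n * (s ^ (-(1 / 2) : ℝ) * (1 - s) ^ (-α)) := by
    have hb : 1 - s ^ (n - 1) ≤ n * (1 - s) := by
      have := one_add_mul_le_pow (a := s - 1) (by linarith) (n - 1)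
      rw [add_sub_cancel] at this
      have hn : ((n - 1 : ℕ) : ℝ) ≤ n := by exact_mod_cast Nat.sub_le n 1
      nlinarith
    -- The factor s^(-1/2) is not needed here; it is inserted so that both terms share the weight
    -- required by the increment term.
    have hone : 1 ≤ s ^ (-(1 / 2) : ℝ) := Real.one_le_rpow_of_pos_of_le_one_of_nonpos h0 h1.le
      (by norm_num)
    have he : (1 - s) * (1 - s) ^ (-(α + 1)) = (1 - s) ^ (-α) := by
      rw [mul_comm, ← Real.rpow_add_one h1'.ne']; congr 1; ring
    calc _ ≤ n * (1 - s) * (1 - s) ^ (-(α + 1)) := by gcongr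
      _ = n * (1 * (1 - s) ^ (-α)) := by rw [mul_assoc, he, one_mul]
      _ ≤ _ := by gcongr
  rw [hsplit]
  calc _ ≤ ENNReal.ofReal (dist P x ^ (-α)) *
        (ENNReal.ofReal ((1 - s ^ (n - 1)) * (1 - s) ^ (-(α + 1))) * ‖f x‖ₑ +
        ENNReal.ofReal (s ^ (n - 1) * (1 - s) ^ (-(α + 1))) * ‖f x - f (P + s • (x - P))‖ₑ) := by
        gcongr
        refine (enorm_add_le _ _).trans (le_of_eq ?_)
        have hnn : ∀ a : ℝ, 0 ≤ a → ‖(a : ℂ)‖ₑ = ENNReal.ofReal a := fun a ha => by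
          rw [← ofReal_norm, Complex.norm_real, Real.norm_of_nonneg ha]
        rw [enorm_mul, enorm_mul, hnn _ (mul_nonneg (sub_nonneg.2 hpow) hrp.le),
          hnn _ (by positivity)]
    _ ≤ ENNReal.ofReal (dist P x ^ (-α)) *
        (ENNReal.ofReal (n * (s ^ (-(1 / 2) : ℝ) * (1 - s) ^ (-α))) * ‖f x‖ₑ +
        ENNReal.ofReal (s ^ (n - 1) * (1 - s) ^ (-(α + 1))) * ‖f x - f (P + s • (x - P))‖ₑ) := by
        gcongr
    _ = _ := by
        rw [ENNReal.ofReal_mul (Nat.cast_nonneg n), ENNReal.ofReal_natCast, radialWeight]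
        ring

/-- Both parts of the fractional derivative are controlled in `L²(Ω)` by the Dirichlet integral. -/
theorem exists_energy_bound (hn : 1 ≤ n) {α : ℝ} (hα₁ : α < 1) (Ω : Opens (E n))
    (hΩ : Convex ℝ (Ω : Set (E n))) (hΩb : Bornology.IsBounded (Ω : Set (E n)))
    (hne : (Ω : Set (E n)).Nonempty) {P : E n} (hP : P ∉ Ω) :
    ∃ C : ℝ≥0∞, C ≠ ∞ ∧ ∀ φ : E n → ℂ, ContDiff ℝ 1 φ → (∀ x ∉ Ω, φ x = 0) →
      ∫⁻ x in (Ω : Set (E n)), radialWeight P α φ x ^ 2 ≤ C * energy φ ∧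
      ∫⁻ x in (Ω : Set (E n)), marchaudMajorant P α φ x ^ 2 ≤ C * energy φ := by
  obtain ⟨C₀, hC₀, hardy⟩ := exists_hardy_const Ω hΩ hne hP
  obtain ⟨D, hD⟩ : ∃ D, ∀ x ∈ (Ω : Set (E n)), dist P x ≤ D := by
    obtain ⟨D, hD⟩ := hΩb.subset_closedBall P
    exact ⟨D, fun x hx => by simpa [dist_comm] using hD hx⟩
  have hΩm : MeasurableSet (Ω : Set (E n)) := Ω.isOpen.measurableSet
  set c : ℝ≥0∞ := ENNReal.ofReal (D ^ (1 - α)) ^ 2 with hc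
  have hct : c ≠ ∞ := by finiteness
  set I : ℝ≥0∞ := ∫⁻ s in Set.Ioo (0 : ℝ) 1, ENNReal.ofReal (s ^ (-(1 / 2) : ℝ) * (1 - s) ^ (-α))
    with hI
  have hIt : I ≠ ∞ := lintegral_rpow_mul_one_sub_rpow_ne_top (by norm_num) (by linarith)
  have hrad : ∀ φ : E n → ℂ, ContDiff ℝ 1 φ → (∀ x ∉ Ω, φ x = 0) →
      ∫⁻ x in (Ω : Set (E n)), radialWeight P α φ x ^ 2 ≤ c * C₀ * energy φ := by
    intro φ hφ hφ0
    calc _ ≤ ∫⁻ x in (Ω : Set (E n)), c * (‖x - P‖ₑ⁻¹ * ‖φ x‖ₑ) ^ 2 := by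
          refine setLIntegral_mono' hΩm fun x hx => ?_
          have hr : 0 < dist P x := dist_pos.2 fun h => hP (h ▸ hx)
          rw [hc, ← mul_pow, ← mul_assoc]
          refine pow_le_pow_left' (mul_le_mul' ?_ le_rfl) 2
          rw [← ofReal_norm, ← dist_eq_norm, dist_comm x P, ← ENNReal.ofReal_inv_of_pos hr,
            ← ENNReal.ofReal_mul' (by positivity)]
          refine ENNReal.ofReal_le_ofReal ?_
          rw [show -α = (1 - α) - 1 by ring, Real.rpow_sub_one hr.ne', div_eq_mul_inv]
          have := hD x hx
          gcongr
      _ = c * ∫⁻ x in (Ω : Set (E n)), (‖x - P‖ₑ⁻¹ * ‖φ x‖ₑ) ^ 2 :=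
          lintegral_const_mul' _ _ hct
      _ ≤ c * (C₀ * energy φ) := by gcongr; exact hardy φ hφ hφ0
      _ = _ := by ring
  -- The first summand serves the radial weight. In the second, 2 comes from squaring a sum, n² from
  -- Bernoulli, and I² from Minkowski.
  refine ⟨c * C₀ + 2 * (n ^ 2 * (c * C₀) + c) * I ^ 2, by finiteness, fun φ hφ hφ0 => ⟨?_, ?_⟩⟩
  · refine (hrad φ hφ hφ0).trans ?_
    gcongr
    exact le_self_add
  have hφm : Measurable φ := hφ.continuous.measurable
  have hmem : ∀ᵐ s ∂(volume.restrict (Set.Ioo (0 : ℝ) 1)), s ∈ Set.Ioo (0 : ℝ) 1 :=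
    ae_restrict_mem measurableSet_Ioo
  refine (lintegral_sq_lintegral_le (C := 2 * (n ^ 2 * (c * C₀) + c) * energy φ)
    (w := fun s => ENNReal.ofReal (s ^ (-(1 / 2) : ℝ) * (1 - s) ^ (-α)))
    (measurable_weighted_marchaudIntegrand P α hφm) (by fun_prop) ?_
    (Eventually.of_forall fun s => ENNReal.ofReal_ne_top) ?_).trans ?_
  · filter_upwards [hmem] with s hs
    have := Real.rpow_pos_of_pos hs.1 (-(1 / 2))
    have := Real.rpow_pos_of_pos (sub_pos.2 hs.2) (-α)
    simp only [ne_eq, ENNReal.ofReal_eq_zero, not_le]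
    positivity
  · filter_upwards [hmem] with s hs
    set w := ENNReal.ofReal (s ^ (-(1 / 2) : ℝ) * (1 - s) ^ (-α)) with hw
    set q := ENNReal.ofReal (s ^ (n - 1) * (1 - s) ^ (-(α + 1))) with hq
    set Δ : E n → ℝ≥0∞ := fun x => ENNReal.ofReal (dist P x ^ (-α)) *
      ‖φ x - φ (P + s • (x - P))‖ₑ with hΔ
    -- The exponent n - 1 - n/2 is at least -1/2 exactly because n ≥ 1.
    have hqw : q * ENNReal.ofReal (s ^ (-(n / 2 : ℝ)) * (1 - s)) ≤ w := by
      have h1 : 0 < 1 - s := sub_pos.2 hs.2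
      rw [hq, hw, ← ENNReal.ofReal_mul (mul_nonneg (pow_nonneg hs.1.le _)
        (Real.rpow_nonneg h1.le _))]
      refine ENNReal.ofReal_le_ofReal ?_
      have e1 : s ^ (n - 1) * s ^ (-(n / 2 : ℝ)) ≤ s ^ (-(1 / 2) : ℝ) := by
        rw [← Real.rpow_natCast, ← Real.rpow_add hs.1]
        refine Real.rpow_le_rpow_of_exponent_ge hs.1 hs.2.le ?_
        have : (1 : ℝ) ≤ n := by exact_mod_cast hn
        push_cast [hn]
        linarith
      have e2 : (1 - s) ^ (-(α + 1)) * (1 - s) = (1 - s) ^ (-α) := by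
        rw [← Real.rpow_add_one h1.ne']; congr 1; ring
      calc _ = (s ^ (n - 1) * s ^ (-(n / 2 : ℝ))) * ((1 - s) ^ (-(α + 1)) * (1 - s)) := by ring
        _ ≤ _ := by
          rw [e2]
          have := Real.rpow_nonneg h1.le (-α)
          gcongr
    calc _ ≤ ∫⁻ x in (Ω : Set (E n)),
          (2 * (n * w) ^ 2 * radialWeight P α φ x ^ 2 + 2 * q ^ 2 * Δ x ^ 2) := by
          refine lintegral_mono fun x => ?_
          refine (pow_le_pow_left' (weighted_marchaudIntegrand_le P α φ x hs) 2).trans ?_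
          refine (add_sq_le_two_mul _ _).trans (le_of_eq ?_)
          ring
      _ = 2 * (n * w) ^ 2 * (∫⁻ x in (Ω : Set (E n)), radialWeight P α φ x ^ 2) +
          2 * q ^ 2 * ∫⁻ x in (Ω : Set (E n)), Δ x ^ 2 := by
          rw [lintegral_add_left (((measurable_radialWeight P α hφm).pow_const 2).const_mul _),
            lintegral_const_mul' _ _ (by finiteness), lintegral_const_mul' _ _ (by finiteness)]
      _ ≤ 2 * (n * w) ^ 2 * (c * C₀ * energy φ) + 2 * q ^ 2 *
          (c * energy φ * ENNReal.ofReal (s ^ (-(n / 2 : ℝ)) * (1 - s)) ^ 2) := by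
          gcongr
          · exact hrad φ hφ hφ0
          · exact lintegral_sq_enorm_sub_homothety_le hφ P hΩm hα₁ hD hP hs
      _ = 2 * (n * w) ^ 2 * (c * C₀ * energy φ) + 2 * (c * energy φ) *
          (q * ENNReal.ofReal (s ^ (-(n / 2 : ℝ)) * (1 - s))) ^ 2 := by ring
      _ ≤ 2 * (n * w) ^ 2 * (c * C₀ * energy φ) + 2 * (c * energy φ) * w ^ 2 := by gcongr
      _ = _ := by ring
  · calc _ = 2 * (n ^ 2 * (c * C₀) + c) * I ^ 2 * energy φ := by ring
      _ ≤ _ := by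
        gcongr
        exact le_add_self

/-! ### Passage from test functions to H¹₀. -/

/-- For fixed s > 0 the homothety is invertible and pulls null sets back to null sets; Fubini
exchanges the quantifiers. Almost everywhere statements thus become usable along rays from P. -/
theorem ae_ae_homothety {p : E n → Prop} (hp : ∀ᵐ x, p x) (P : E n) :
    ∀ᵐ x, ∀ᵐ s ∂(volume.restrict (Set.Ioo (0 : ℝ) 1)), p (P + s • (x - P)) := by
  obtain ⟨N, hpN, hN, hN0⟩ := exists_measurable_superset_of_null (ae_iff.1 hp)
  have hmeas : MeasurableSet {q : E n × ℝ | P + q.2 • (q.1 - P) ∉ N} :=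
    (hN.preimage (by fun_prop : Measurable fun q : E n × ℝ => P + q.2 • (q.1 - P))).compl
  have hNae : ∀ᵐ x : E n, x ∉ N := measure_eq_zero_iff_ae_notMem.1 hN0
  have h : ∀ᵐ x, ∀ᵐ s ∂(volume.restrict (Set.Ioo (0 : ℝ) 1)), P + s • (x - P) ∉ N := by
    refine (Measure.ae_ae_comm (p := fun (x : E n) (s : ℝ) => P + s • (x - P) ∉ N) hmeas).2 ?_
    filter_upwards [ae_restrict_mem measurableSet_Ioo] with s hs
    have hdet : LinearMap.det (s • (LinearMap.id : E n →ₗ[ℝ] E n)) ≠ 0 := by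
      have := hs.1.ne'
      simp [this]
    have h := ae_comp_linearMap_sub (p := fun x => x ∉ N) (s • LinearMap.id) hdet P hNae
    simpa only [LinearMap.smul_apply, LinearMap.id_apply] using h
  filter_upwards [h] with x hx
  filter_upwards [hx] with s hs
  by_contra hps
  exact hs (hpN hps)

theorem sq_liminf_ennreal (u : ℕ → ℝ≥0∞) :
    (liminf u atTop) ^ 2 = liminf (fun k => u k ^ 2) atTop :=
  Monotone.map_liminf_of_continuousAt (f := fun a : ℝ≥0∞ => a ^ 2)
    (fun _ _ h => pow_le_pow_left' h 2) u (ENNReal.continuous_pow 2).continuousAt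

theorem lintegral_sq_le_of_ae_le_liminf {μ : Measure (E n)} {g : E n → ℝ≥0∞}
    {u : ℕ → E n → ℝ≥0∞} (hu : ∀ k, Measurable (u k))
    (hg : ∀ᵐ x ∂μ, g x ≤ liminf (fun k => u k x) atTop) {N : ℕ → ℝ≥0∞} {M : ℝ≥0∞}
    (hN : ∀ k, ∫⁻ x, u k x ^ 2 ∂μ ≤ N k) (hM : Tendsto N atTop (𝓝 M)) :
    ∫⁻ x, g x ^ 2 ∂μ ≤ M := by
  calc _ ≤ ∫⁻ x, liminf (fun k => u k x ^ 2) atTop ∂μ := by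
        refine lintegral_mono_ae ?_
        filter_upwards [hg] with x hx
        rw [← sq_liminf_ennreal]
        exact pow_le_pow_left' hx 2
    _ ≤ liminf (fun k => ∫⁻ x, u k x ^ 2 ∂μ) atTop :=
        lintegral_liminf_le fun k => (hu k).pow_const 2
    _ ≤ liminf N atTop := liminf_le_liminf (Eventually.of_forall hN)
    _ = M := hM.liminf_eq

theorem radialWeight_le_liminf (P : E n) (α : ℝ) {f : E n → ℂ} {φ : ℕ → E n → ℂ} {x : E n}
    (h : Tendsto (fun k => φ k x) atTop (𝓝 (f x))) :
    radialWeight P α f x ≤ liminf (fun k => radialWeight P α (φ k) x) atTop :=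
  (ENNReal.Tendsto.const_mul h.enorm (Or.inr ENNReal.ofReal_ne_top)).liminf_eq.ge

theorem marchaudMajorant_le_liminf (P : E n) (α : ℝ) {f : E n → ℂ} {φ : ℕ → E n → ℂ}
    (hφ : ∀ k, Measurable (φ k)) {x : E n} (h : Tendsto (fun k => φ k x) atTop (𝓝 (f x)))
    (hs : ∀ᵐ s ∂(volume.restrict (Set.Ioo (0 : ℝ) 1)),
      Tendsto (fun k => φ k (P + s • (x - P))) atTop (𝓝 (f (P + s • (x - P))))) :
    marchaudMajorant P α f x ≤ liminf (fun k => marchaudMajorant P α (φ k) x) atTop := by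
  have hm : ∀ k, Measurable fun s =>
      ENNReal.ofReal (dist P x ^ (-α)) * ‖marchaudIntegrand P α (φ k) x s‖ₑ := fun k =>
    (measurable_weighted_marchaudIntegrand P α (hφ k)).of_uncurry_left
  refine le_trans (lintegral_mono_ae ?_) (lintegral_liminf_le hm)
  filter_upwards [hs] with s hs
  refine Tendsto.liminf_eq ?_ |>.ge
  refine ENNReal.Tendsto.const_mul (Tendsto.enorm ?_) (Or.inr ENNReal.ofReal_ne_top)
  exact (h.sub (hs.const_mul _)).mul_const _

theorem eLpNorm_two_sq {X F : Type*} [MeasurableSpace X] [NormedAddCommGroup F] (μ : Measure X)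
    (f : X → F) : eLpNorm f 2 μ ^ 2 = ∫⁻ x, ‖f x‖ₑ ^ 2 ∂μ := by
  have := eLpNorm_nnreal_pow_eq_lintegral (μ := μ) (f := f) (p := 2) two_ne_zero
  simpa using this

theorem norm_clm_sq_le (L : E n →L[ℝ] ℂ) :
    ‖L‖ ^ 2 ≤ ∑ i, ‖L (EuclideanSpace.single i 1)‖ ^ 2 := by
  have h : ‖L‖ ≤ √(∑ i, ‖L (EuclideanSpace.single i 1)‖ ^ 2) := by
    refine L.opNorm_le_bound (Real.sqrt_nonneg _) fun x => ?_
    have hx : x = ∑ i, x i • EuclideanSpace.single i (1 : ℝ) := by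
      simpa using ((EuclideanSpace.basisFun (Fin n) ℝ).sum_repr x).symm
    calc ‖L x‖ = ‖∑ i, x i • L (EuclideanSpace.single i 1)‖ := by
          conv_lhs => rw [hx]
          simp only [map_sum, map_smul]
      _ ≤ ∑ i, ‖L (EuclideanSpace.single i 1)‖ * ‖x i‖ := by
          refine (norm_sum_le _ _).trans (Finset.sum_le_sum fun i _ => ?_)
          rw [norm_smul, mul_comm]
      _ ≤ _ := by
          rw [EuclideanSpace.norm_eq]
          exact Real.sum_mul_le_sqrt_mul_sqrt _ _ _
  calc ‖L‖ ^ 2 ≤ √(∑ i, ‖L (EuclideanSpace.single i 1)‖ ^ 2) ^ 2 := by gcongr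
    _ = _ := Real.sq_sqrt (Finset.sum_nonneg fun i _ => by positivity)

theorem testFunction_eq_zero {Ω : Opens (E n)} (φ : 𝓓(Ω, ℂ)) {x : E n} (hx : x ∉ Ω) : φ x = 0 :=
  image_eq_zero_of_notMem_tsupport fun h => hx (φ.tsupport_subset h)

theorem contDiff_one_testFunction {Ω : Opens (E n)} (φ : 𝓓(Ω, ℂ)) : ContDiff ℝ 1 φ :=
  φ.contDiff.of_le (by exact_mod_cast le_top)

/-- The gradient vanishes off Ω, and the operator norm is at most the Euclidean norm of the partial
derivatives. -/
theorem energy_testFunction_le {Ω : Opens (E n)} (φ : 𝓓(Ω, ℂ)) :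
    energy φ ≤ ∑ i, eLpNorm (partialDeriv i φ) 2 (volume.restrict (Ω : Set (E n))) ^ 2 := by
  have hc : ∀ i, Measurable (partialDeriv i φ) := fun i =>
    (((contDiff_one_testFunction φ).continuous_fderiv one_ne_zero).clm_apply
      continuous_const).measurable
  have hsupp : ∀ x ∉ (Ω : Set (E n)), fderiv ℝ φ x = 0 := fun x hx => by
    by_contra h
    exact hx (φ.tsupport_subset (support_fderiv_subset ℝ h))
  simp only [eLpNorm_two_sq]
  rw [energy, ← lintegral_finsetSum _ fun i _ => (hc i).enorm.pow_const 2,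
    ← setLIntegral_eq_of_support_subset (s := (Ω : Set (E n)))]
  · refine lintegral_mono fun x => ?_
    simp only [← ofReal_norm, ← ENNReal.ofReal_pow (norm_nonneg _)]
    rw [← ENNReal.ofReal_sum_of_nonneg fun i _ => by positivity]
    exact ENNReal.ofReal_le_ofReal (norm_clm_sq_le _)
  · intro x hx
    by_contra h
    refine hx ?_
    simp only [hsupp x h]
    rw [← ofReal_norm, norm_zero, ENNReal.ofReal_zero, zero_pow two_ne_zero]

theorem sum_eLpNorm_sq_weakDeriv {Ω : Opens (E n)} {f : E n → ℂ} (hf : MemH1 Ω f) :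
    ∑ i, eLpNorm (weakDeriv Ω i f) 2 (volume.restrict (Ω : Set (E n))) ^ 2 =
      ENNReal.ofReal (normH10 Ω f) ^ 2 := by
  rw [normH10, ← ENNReal.ofReal_pow (Real.sqrt_nonneg _), Real.sq_sqrt,
    ENNReal.ofReal_sum_of_nonneg]
  · refine Finset.sum_congr rfl fun i _ => ?_
    rw [eLpNorm_two_sq, ofReal_integral_eq_lintegral_ofReal
      ((memLp_two_iff_integrable_sq_norm (hf.2 i).2.1).1 (hf.2 i).2)
      (Eventually.of_forall fun x => by positivity)]
    refine lintegral_congr fun x => ?_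
    rw [← ofReal_norm, ENNReal.ofReal_pow (norm_nonneg _)]
  · exact fun i _ => integral_nonneg fun x => by positivity
  · exact Finset.sum_nonneg fun i _ => integral_nonneg fun x => by positivity

/-- A measurable representative of an element of `H¹₀(Ω)`, together with the limiting form
of the bounds of `exists_energy_bound`. -/
theorem MemH10.exists_representative {Ω : Opens (E n)} {P : E n} {α : ℝ} {C : ℝ≥0∞} (hC : C ≠ ∞)
    (hbound : ∀ φ : E n → ℂ, ContDiff ℝ 1 φ → (∀ x ∉ Ω, φ x = 0) →
      ∫⁻ x in (Ω : Set (E n)), radialWeight P α φ x ^ 2 ≤ C * energy φ ∧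
      ∫⁻ x in (Ω : Set (E n)), marchaudMajorant P α φ x ^ 2 ≤ C * energy φ)
    {f : E n → ℂ} (hf : MemH10 Ω f) :
    ∃ g : E n → ℂ, Measurable g ∧ (∀ᵐ x, x ∈ Ω → f x = g x) ∧
      ∫⁻ x in (Ω : Set (E n)), radialWeight P α g x ^ 2 ≤
        C * ENNReal.ofReal (normH10 Ω f) ^ 2 ∧
      ∫⁻ x in (Ω : Set (E n)), marchaudMajorant P α g x ^ 2 ≤
        C * ENNReal.ofReal (normH10 Ω f) ^ 2 := by
  obtain ⟨hH1, φ, hφ, hφD⟩ := hf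
  have hΩm : MeasurableSet (Ω : Set (E n)) := Ω.isOpen.measurableSet
  have hfm := hH1.1.1
  -- Extension by zero matches the test functions off Ω, so the subsequence converges almost
  -- everywhere in the whole space and hence along almost every ray.
  set g : E n → ℂ := (Ω : Set (E n)).indicator (hfm.mk f) with hg
  have hgm : Measurable g := hfm.stronglyMeasurable_mk.measurable.indicator hΩm
  have hfg : ∀ᵐ x, x ∈ Ω → f x = g x := by
    filter_upwards [(ae_restrict_iff' hΩm).1 hfm.ae_eq_mk] with x hx hxΩ
    rw [hg, Set.indicator_of_mem hxΩ, hx hxΩ]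
  have hφm : ∀ k, Measurable (φ k) := fun k => (φ k).continuous.measurable
  obtain ⟨ns, hns, hlim⟩ := (tendstoInMeasure_of_tendsto_eLpNorm two_ne_zero
    (fun k => (hφm k).aestronglyMeasurable) hfm hφ).exists_seq_tendsto_ae
  have hlim' : ∀ᵐ x, Tendsto (fun k => φ (ns k) x) atTop (𝓝 (g x)) := by
    filter_upwards [(ae_restrict_iff' hΩm).1 hlim, hfg] with x hx hx'
    by_cases hxΩ : x ∈ Ω
    · rw [← hx' hxΩ]; exact hx hxΩ
    · rw [hg, Set.indicator_of_notMem hxΩ]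
      simp only [testFunction_eq_zero _ hxΩ]
      exact tendsto_const_nhds
  set N : ℕ → ℝ≥0∞ := fun k =>
    C * ∑ i, eLpNorm (partialDeriv i (φ (ns k))) 2 (volume.restrict (Ω : Set (E n))) ^ 2
  have hN : Tendsto N atTop (𝓝 (C * ENNReal.ofReal (normH10 Ω f) ^ 2)) := by
    rw [← sum_eLpNorm_sq_weakDeriv hH1]
    refine ENNReal.Tendsto.const_mul (tendsto_finsetSum _ fun i _ => ?_) (Or.inr hC)
    refine (ENNReal.continuous_pow 2).continuousAt.tendsto.comp ?_
    have hw := (hH1.2 i).2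
    have hd : ∀ k, AEStronglyMeasurable (partialDeriv i (φ (ns k)))
        (volume.restrict (Ω : Set (E n))) := fun k =>
      (((contDiff_one_testFunction (φ (ns k))).continuous_fderiv one_ne_zero).clm_apply
        continuous_const).aestronglyMeasurable
    have h0 := (hφD i).comp hns.tendsto_atTop
    have hup : Tendsto (fun k => eLpNorm (fun x => partialDeriv i (φ (ns k)) x -
        weakDeriv Ω i f x) 2 (volume.restrict (Ω : Set (E n))) +
        eLpNorm (weakDeriv Ω i f) 2 (volume.restrict (Ω : Set (E n)))) atTop
        (𝓝 (eLpNorm (weakDeriv Ω i f) 2 (volume.restrict (Ω : Set (E n))))) := by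
      simpa using h0.add_const (eLpNorm (weakDeriv Ω i f) 2 (volume.restrict (Ω : Set (E n))))
    -- Reverse triangle inequality in truncated subtraction; its limit uses the finiteness of the
    -- norm of the weak derivative.
    have hlow : Tendsto (fun k => eLpNorm (weakDeriv Ω i f) 2 (volume.restrict (Ω : Set (E n))) -
        eLpNorm (fun x => partialDeriv i (φ (ns k)) x -
        weakDeriv Ω i f x) 2 (volume.restrict (Ω : Set (E n)))) atTop
        (𝓝 (eLpNorm (weakDeriv Ω i f) 2 (volume.restrict (Ω : Set (E n))))) := by
      simpa using ENNReal.Tendsto.sub (tendsto_const_nhds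
        (x := eLpNorm (weakDeriv Ω i f) 2 (volume.restrict (Ω : Set (E n))))) h0
        (Or.inl hw.2.ne)
    refine tendsto_of_tendsto_of_tendsto_of_le_of_le hlow hup (fun k => ?_) fun k => ?_
    · rw [tsub_le_iff_right]
      have := eLpNorm_sub_le (hd k) ((hd k).sub hw.1) (p := 2) (by norm_num)
      simpa [Pi.sub_def] using this
    · have := eLpNorm_add_le ((hd k).sub hw.1) hw.1 (p := 2) (by norm_num)
      simpa [Pi.sub_def, Pi.add_def] using this
  have hNle : ∀ k, C * energy (φ (ns k)) ≤ N k := fun k => by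
    simp only [N]; gcongr; exact energy_testFunction_le _
  have hb := fun k => hbound (φ (ns k)) (contDiff_one_testFunction _)
    fun x hx => testFunction_eq_zero _ hx
  refine ⟨g, hgm, hfg, ?_, ?_⟩
  · refine lintegral_sq_le_of_ae_le_liminf (fun k => measurable_radialWeight P α (hφm (ns k)))
      (ae_restrict_of_ae ?_) (fun k => (hb k).1.trans (hNle k)) hN
    filter_upwards [hlim'] with x hx
    exact radialWeight_le_liminf P α hx
  · refine lintegral_sq_le_of_ae_le_liminf (fun k => measurable_marchaudMajorant P α (hφm (ns k)))
      (ae_restrict_of_ae ?_) (fun k => (hb k).2.trans (hNle k)) hN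
    filter_upwards [hlim', ae_ae_homothety hlim' P] with x hx hxs
    exact marchaudMajorant_le_liminf P α (fun k => hφm (ns k)) hx hxs

/-! ### Scaled form of the derivative, domination and convergence. -/

/-- The fractional derivative, with the integration in the variable `s = t / r` extending up to
`b`. -/
noncomputable def scaledLeftDeriv (P : E n) (α b : ℝ) (f : E n → ℂ) (x : E n) : ℂ :=
  ((α / Real.Gamma (1 - α) : ℝ) : ℂ) * (((dist P x ^ (-α) : ℝ) : ℂ) *
    ∫ s in Set.Ioc 0 b, marchaudIntegrand P α f x s) +
  ((Real.Gamma (1 - α))⁻¹ : ℝ) * (((dist P x ^ (-α) : ℝ) : ℂ) * f x)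

theorem truncLeftDeriv_of_le {P x : E n} (hx : P ≠ x) (α : ℝ) {ε : ℝ} (hε : 0 < ε)
    (hεx : ε ≤ dist P x) (f : E n → ℂ) :
    truncLeftDeriv P α ε f x = scaledLeftDeriv P α (1 - ε / dist P x) f x := by
  have hr : 0 < dist P x := dist_pos.2 hx
  simp only [truncLeftDeriv, if_pos hεx, scaledLeftDeriv]
  set r := dist P x with hrdef
  have hb : 0 ≤ 1 - ε / r := sub_nonneg.2 ((div_le_one hr).2 hεx)
  have hb1 : 1 - ε / r < 1 := by linarith [div_pos hε hr]
  have hint : (∫ t in (0 : ℝ)..(r - ε),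
      (f x * ((r ^ (n - 1) : ℝ) : ℂ) - f (P + t • r⁻¹ • (x - P)) * ((t ^ (n - 1) : ℝ) : ℂ)) /
        (((r - t) ^ (α + 1) * r ^ (n - 1) : ℝ) : ℂ)) =
      ((r ^ (-α) : ℝ) : ℂ) * ∫ s in Set.Ioc 0 (1 - ε / r), marchaudIntegrand P α f x s := by
    have h := intervalIntegral.smul_integral_comp_mul_left (a := 0) (b := 1 - ε / r)
      (fun t : ℝ => (f x * ((r ^ (n - 1) : ℝ) : ℂ) -
        f (P + t • r⁻¹ • (x - P)) * ((t ^ (n - 1) : ℝ) : ℂ)) /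
          (((r - t) ^ (α + 1) * r ^ (n - 1) : ℝ) : ℂ)) r
    rw [mul_zero, show r * (1 - ε / r) = r - ε by field_simp] at h
    rw [← h, ← intervalIntegral.integral_of_le hb, ← intervalIntegral.integral_const_mul,
      ← intervalIntegral.integral_smul]
    refine intervalIntegral.integral_congr fun s hs => ?_
    rw [Set.uIcc_of_le hb] at hs
    have hs1 : 0 < 1 - s := by linarith [hs.2]
    have hpt : (r * s) • r⁻¹ • (x - P) = s • (x - P) := by
      rw [smul_smul]; congr 1; field_simp
    have hden : (r - r * s) ^ (α + 1) = r * r ^ α * (1 - s) ^ (α + 1) := by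
      rw [show r - r * s = r * (1 - s) by ring, Real.mul_rpow hr.le hs1.le,
        Real.rpow_add_one hr.ne']
      ring
    have h1 : ((r ^ α : ℝ) : ℂ) ≠ 0 := by exact_mod_cast (Real.rpow_pos_of_pos hr α).ne'
    have h2 : (((1 - s) ^ (α + 1) : ℝ) : ℂ) ≠ 0 := by
      exact_mod_cast (Real.rpow_pos_of_pos hs1 (α + 1)).ne'
    have h3 : (r : ℂ) ≠ 0 := by exact_mod_cast hr.ne'
    simp only [marchaudIntegrand, hpt, hden, Real.rpow_neg hr.le, Real.rpow_neg hs1.le,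
      Complex.real_smul]
    push_cast at h1 h2 ⊢
    field_simp
    ring
  rw [hint]
  push_cast
  ring

theorem truncLeftDeriv_of_lt {P x : E n} (α : ℝ) {ε : ℝ} (hεx : dist P x < ε) (f : E n → ℂ) :
    truncLeftDeriv P α ε f x = f x / ((ε ^ α : ℝ) : ℂ) := by
  simp only [truncLeftDeriv, if_neg hεx.not_ge]

theorem measurable_scaledLeftDeriv (P : E n) (α : ℝ) {b : E n → ℝ} (hb : Measurable b)
    {f : E n → ℂ} (hf : Measurable f) : Measurable fun x => scaledLeftDeriv P α (b x) f x := by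
  have hI : Measurable fun x => ∫ s in Set.Ioc 0 (b x), marchaudIntegrand P α f x s := by
    have hset : MeasurableSet {p : E n × ℝ | p.2 ∈ Set.Ioc 0 (b p.1)} :=
      (measurableSet_lt measurable_const measurable_snd).inter
        (measurableSet_le measurable_snd (hb.comp measurable_fst))
    have hm := (measurable_marchaudIntegrand P α hf).indicator hset
    have := hm.stronglyMeasurable.integral_prod_right' (ν := volume)
    convert! this.measurable using 2 with x
    rw [← integral_indicator measurableSet_Ioc]
    rfl
  unfold scaledLeftDeriv
  fun_prop

theorem measurable_truncLeftDeriv (P : E n) (α : ℝ) {ε : ℝ} (hε : 0 < ε) {f : E n → ℂ}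
    (hf : Measurable f) : Measurable (truncLeftDeriv P α ε f) := by
  have h : truncLeftDeriv P α ε f = fun x => if ε ≤ dist P x then
      scaledLeftDeriv P α (1 - ε / dist P x) f x else f x / ((ε ^ α : ℝ) : ℂ) := by
    funext x
    split_ifs with hx
    · exact truncLeftDeriv_of_le (dist_pos.1 (hε.trans_le hx)) α hε hx f
    · exact truncLeftDeriv_of_lt α (not_le.1 hx) f
  rw [h]
  exact Measurable.ite (measurableSet_le measurable_const (by fun_prop))
    (measurable_scaledLeftDeriv P α (by fun_prop) hf) (hf.div_const _)

/-- A pointwise majorant of all truncated fractional derivatives of `f`. -/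
noncomputable def leftDerivMajorant (P : E n) (α : ℝ) (f : E n → ℂ) (x : E n) : ℝ≥0∞ :=
  ENNReal.ofReal (α / Real.Gamma (1 - α)) * marchaudMajorant P α f x +
    ENNReal.ofReal ((Real.Gamma (1 - α))⁻¹ + 1) * radialWeight P α f x

theorem enorm_ofReal_of_nonneg {a : ℝ} (ha : 0 ≤ a) : ‖(a : ℂ)‖ₑ = ENNReal.ofReal a := by
  rw [← ofReal_norm, Complex.norm_real, Real.norm_of_nonneg ha]

theorem enorm_scaledLeftDeriv_le (P : E n) {α b : ℝ} (hα₀ : 0 < α) (hα₁ : α < 1) (hb : b ≤ 1)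
    (f : E n → ℂ) (x : E n) : ‖scaledLeftDeriv P α b f x‖ₑ ≤ leftDerivMajorant P α f x := by
  have hΓ : 0 < Real.Gamma (1 - α) := Real.Gamma_pos_of_pos (sub_pos.2 hα₁)
  have hr : 0 ≤ dist P x ^ (-α) := Real.rpow_nonneg dist_nonneg _
  refine (enorm_add_le _ _).trans (add_le_add ?_ ?_)
  · rw [enorm_mul, enorm_ofReal_of_nonneg (by positivity), enorm_mul, enorm_ofReal_of_nonneg hr]
    gcongr
    rw [marchaudMajorant, lintegral_const_mul' _ _ ENNReal.ofReal_ne_top]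
    gcongr
    refine (enorm_integral_le_lintegral_enorm _).trans ?_
    rw [setLIntegral_congr (Ioo_ae_eq_Ioc (a := (0 : ℝ)) (b := 1))]
    exact lintegral_mono_set (Set.Ioc_subset_Ioc_right hb)
  · rw [enorm_mul, enorm_ofReal_of_nonneg (by positivity), enorm_mul, enorm_ofReal_of_nonneg hr]
    exact mul_le_mul' (ENNReal.ofReal_le_ofReal (by linarith)) le_rfl

/-- When r < ε, one has ε^(-α) ≤ r^(-α), so the radial term alone suffices; the added 1 in the
majorant makes its coefficient at least one. -/
theorem enorm_truncLeftDeriv_le {P x : E n} (hx : P ≠ x) {α ε : ℝ} (hα₀ : 0 < α) (hα₁ : α < 1)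
    (hε : 0 < ε) (f : E n → ℂ) :
    ‖truncLeftDeriv P α ε f x‖ₑ ≤ leftDerivMajorant P α f x := by
  have hr : 0 < dist P x := dist_pos.2 hx
  rcases le_or_gt ε (dist P x) with h | h
  · rw [truncLeftDeriv_of_le hx α hε h]
    exact enorm_scaledLeftDeriv_le P hα₀ hα₁ (by linarith [div_pos hε hr]) f x
  · have hΓ : 0 < Real.Gamma (1 - α) := Real.Gamma_pos_of_pos (sub_pos.2 hα₁)
    rw [truncLeftDeriv_of_lt α h, div_eq_inv_mul, ← Complex.ofReal_inv, enorm_mul,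
      enorm_ofReal_of_nonneg (by positivity), ← Real.rpow_neg hε.le]
    refine le_trans ?_ le_add_self
    calc _ ≤ radialWeight P α f x := mul_le_mul' (ENNReal.ofReal_le_ofReal
          (Real.rpow_le_rpow_of_nonpos hr h.le (by linarith))) le_rfl
      _ ≤ _ := le_mul_of_one_le_left' (ENNReal.one_le_ofReal.2 (by linarith [inv_pos.2 hΓ]))

theorem tendsto_truncLeftDeriv {P x : E n} (hx : P ≠ x) {α : ℝ} {f : E n → ℂ}
    (hf : Measurable f) (hM : marchaudMajorant P α f x ≠ ∞) :
    Tendsto (fun ε : ℝ => truncLeftDeriv P α ε f x) (𝓝[>] 0)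
      (𝓝 (scaledLeftDeriv P α 1 f x)) := by
  have hr : 0 < dist P x := dist_pos.2 hx
  -- A finite majorant makes the integrand absolutely integrable up to s = 1, so its primitive is
  -- continuous there.
  have hint : IntegrableOn (marchaudIntegrand P α f x) (Set.uIcc 0 1) := by
    rw [Set.uIcc_of_le zero_le_one, integrableOn_Icc_iff_integrableOn_Ioo]
    refine ⟨(measurable_marchaudIntegrand P α hf).of_uncurry_left.aestronglyMeasurable, ?_⟩
    rw [marchaudMajorant, lintegral_const_mul' _ _ ENNReal.ofReal_ne_top] at hM
    refine (ENNReal.lt_top_of_mul_ne_top_right hM ?_)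
    have := Real.rpow_pos_of_pos hr (-α)
    simpa using this
  have hc := intervalIntegral.continuousOn_primitive_interval hint 1 (by simp)
  have hb : Tendsto (fun ε : ℝ => 1 - ε / dist P x) (𝓝[>] 0) (𝓝[Set.uIcc 0 1] 1) := by
    refine tendsto_nhdsWithin_iff.2 ⟨?_, ?_⟩
    · have : ContinuousAt (fun ε : ℝ => 1 - ε / dist P x) 0 := by fun_prop
      have h := this.tendsto
      simp only [zero_div, sub_zero] at h
      exact h.mono_left nhdsWithin_le_nhds
    · filter_upwards [Ioc_mem_nhdsGT hr] with ε hε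
      rw [Set.uIcc_of_le zero_le_one]
      exact ⟨sub_nonneg.2 ((div_le_one hr).2 hε.2), by linarith [div_pos hε.1 hr]⟩
  have hI : Tendsto (fun ε : ℝ => ∫ s in Set.Ioc 0 (1 - ε / dist P x), marchaudIntegrand P α f x s)
      (𝓝[>] 0) (𝓝 (∫ s in Set.Ioc 0 1, marchaudIntegrand P α f x s)) := by
    rw [← intervalIntegral.integral_of_le zero_le_one]
    refine (hc.tendsto.comp hb).congr' ?_
    filter_upwards [Ioc_mem_nhdsGT hr] with ε hε
    exact intervalIntegral.integral_of_le (sub_nonneg.2 ((div_le_one hr).2 hε.2))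
  have h : Tendsto (fun ε : ℝ => scaledLeftDeriv P α (1 - ε / dist P x) f x) (𝓝[>] 0)
      (𝓝 (scaledLeftDeriv P α 1 f x)) :=
    ((hI.const_mul _).const_mul _).add_const _
  refine h.congr' ?_
  filter_upwards [Ioc_mem_nhdsGT hr] with ε hε
  exact (truncLeftDeriv_of_le hx α hε.1 hε.2 f).symm

theorem truncLeftDeriv_congr {P x : E n} (hx : P ≠ x) (α : ℝ) {f g : E n → ℂ} (h : f x = g x)
    (hs : ∀ᵐ s ∂(volume.restrict (Set.Ioo (0 : ℝ) 1)), f (P + s • (x - P)) = g (P + s • (x - P)))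
    {ε : ℝ} (hε : 0 < ε) : truncLeftDeriv P α ε f x = truncLeftDeriv P α ε g x := by
  have hr : 0 < dist P x := dist_pos.2 hx
  rcases le_or_gt ε (dist P x) with hle | hlt
  · rw [truncLeftDeriv_of_le hx α hε hle, truncLeftDeriv_of_le hx α hε hle, scaledLeftDeriv,
      scaledLeftDeriv, h]
    congr 3
    refine setIntegral_congr_ae₀ measurableSet_Ioc.nullMeasurableSet ?_
    filter_upwards [(ae_restrict_iff' measurableSet_Ioo).1 hs] with s hs hsb
    have := hs ⟨hsb.1, hsb.2.trans_lt (by linarith [div_pos hε hr])⟩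
    simp only [marchaudIntegrand, h, this]
  · rw [truncLeftDeriv_of_lt α hlt, truncLeftDeriv_of_lt α hlt, h]

/-- By convexity the open segment from the boundary point P to a point of Ω stays in Ω, so values
off Ω never enter. The exceptional null set is independent of ε. -/
theorem ae_truncLeftDeriv_eq {Ω : Opens (E n)} (hΩ : Convex ℝ (Ω : Set (E n))) {P : E n}
    (hP : P ∈ frontier (Ω : Set (E n))) (α : ℝ) {f g : E n → ℂ}
    (h : ∀ᵐ x, x ∈ Ω → f x = g x) :
    ∀ᵐ x ∂(volume.restrict (Ω : Set (E n))), ∀ ε : ℝ, 0 < ε →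
      truncLeftDeriv P α ε f x = truncLeftDeriv P α ε g x := by
  rw [Ω.isOpen.frontier_eq] at hP
  rw [ae_restrict_iff' Ω.isOpen.measurableSet]
  filter_upwards [h, ae_ae_homothety h P] with x hx hxs hxΩ ε hε
  refine truncLeftDeriv_congr (fun h : P = x => hP.2 (h ▸ hxΩ)) α (hx hxΩ) ?_ hε
  filter_upwards [hxs, ae_restrict_mem measurableSet_Ioo] with s hs hs01
  refine hs (interior_subset ?_)
  exact hΩ.add_smul_sub_mem_interior' hP.1 (by rwa [Ω.isOpen.interior_eq]) ⟨hs01.1, hs01.2.le⟩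

theorem tendsto_zero_of_sq_ennreal {ι : Type*} {l : Filter ι} {u : ι → ℝ≥0∞}
    (h : Tendsto (fun i => u i ^ 2) l (𝓝 0)) : Tendsto u l (𝓝 0) := by
  have h2 := (ENNReal.continuous_rpow_const (y := (1 / 2 : ℝ))).continuousAt.tendsto.comp h
  rw [ENNReal.zero_rpow_of_pos (by norm_num)] at h2
  refine h2.congr fun i => ?_
  rw [Function.comp_apply, ← ENNReal.rpow_natCast, ← ENNReal.rpow_mul]
  norm_num

theorem ofReal_normL2_sq {Ω : Opens (E n)} {g : E n → ℂ}
    (hg : MemLp g 2 (volume.restrict (Ω : Set (E n)))) :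
    ENNReal.ofReal (normL2 Ω g) ^ 2 = eLpNorm g 2 (volume.restrict (Ω : Set (E n))) ^ 2 := by
  rw [normL2, ← ENNReal.ofReal_pow (Real.sqrt_nonneg _), Real.sq_sqrt
    (integral_nonneg fun x => by positivity), eLpNorm_two_sq, ofReal_integral_eq_lintegral_ofReal
      ((memLp_two_iff_integrable_sq_norm hg.1).1 hg) (Eventually.of_forall fun x => by positivity)]
  refine lintegral_congr fun x => ?_
  rw [← ofReal_norm, ENNReal.ofReal_pow (norm_nonneg _)]

/-- If the pointwise majorant of the truncated derivatives is square integrable, then these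
converge in `L²(Ω)`. -/
theorem hasLeftDeriv_of_majorant {Ω : Opens (E n)} (hΩ : Convex ℝ (Ω : Set (E n))) {P : E n}
    (hP : P ∈ frontier (Ω : Set (E n))) {α : ℝ} (hα₀ : 0 < α) (hα₁ : α < 1) {f g : E n → ℂ}
    (hg : Measurable g) (h : ∀ᵐ x, x ∈ Ω → f x = g x)
    (hM : ∫⁻ x in (Ω : Set (E n)), leftDerivMajorant P α g x ^ 2 ≠ ∞) :
    HasLeftDeriv Ω P α 2 f (scaledLeftDeriv P α 1 g) := by
  set μ := volume.restrict (Ω : Set (E n)) with hμ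
  have hPΩ : ∀ᵐ x ∂μ, P ≠ x := by
    filter_upwards [ae_restrict_mem Ω.isOpen.measurableSet] with x hx h
    rw [Ω.isOpen.frontier_eq] at hP
    exact hP.2 (h ▸ hx)
  have hae := ae_truncLeftDeriv_eq hΩ hP α h
  have hBm : Measurable fun x => leftDerivMajorant P α g x ^ 2 := by
    have h1 := measurable_marchaudMajorant P α hg
    have h2 := measurable_radialWeight P α hg
    unfold leftDerivMajorant
    fun_prop
  have hmeas : Measurable (scaledLeftDeriv P α 1 g) :=
    measurable_scaledLeftDeriv P α measurable_const hg
  have hmem : ∀ u : E n → ℂ, AEStronglyMeasurable u μ →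
      (∀ᵐ x ∂μ, ‖u x‖ₑ ≤ leftDerivMajorant P α g x) → MemLp u 2 μ := by
    intro u hu hub
    refine ⟨hu, ?_⟩
    have : eLpNorm u 2 μ ^ 2 < ∞ := by
      rw [eLpNorm_two_sq]
      refine lt_of_le_of_lt (lintegral_mono_ae ?_) hM.lt_top
      filter_upwards [hub] with x hx using pow_le_pow_left' hx 2
    simpa using this
  refine ⟨hmem _ hmeas.aestronglyMeasurable
    (Eventually.of_forall fun x => enorm_scaledLeftDeriv_le P hα₀ hα₁ le_rfl g x), ?_, ?_⟩
  · intro ε hε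
    have heq : truncLeftDeriv P α ε f =ᵐ[μ] truncLeftDeriv P α ε g := by
      filter_upwards [hae] with x hx using hx ε hε
    refine (memLp_congr_ae heq).2 (hmem _
      (measurable_truncLeftDeriv P α hε hg).aestronglyMeasurable ?_)
    filter_upwards [hPΩ] with x hx using enorm_truncLeftDeriv_le hx hα₀ hα₁ hε g
  · have hB : ∀ᵐ x ∂μ, leftDerivMajorant P α g x ^ 2 < ∞ := ae_lt_top hBm hM
    have hlim : Tendsto (fun ε : ℝ => ∫⁻ x, ‖truncLeftDeriv P α ε g x -
        scaledLeftDeriv P α 1 g x‖ₑ ^ 2 ∂μ) (𝓝[>] 0) (𝓝 (∫⁻ _, 0 ∂μ)) := by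
      refine tendsto_lintegral_filter_of_dominated_convergence
        -- Truncation and limit are each bounded by the majorant B, whence (2B)² = 4B².
        (fun x => 4 * leftDerivMajorant P α g x ^ 2) ?_ ?_ ?_ ?_
      · filter_upwards [self_mem_nhdsWithin] with ε hε
        exact (((measurable_truncLeftDeriv P α hε hg).sub hmeas).enorm.pow_const 2)
      · filter_upwards [self_mem_nhdsWithin] with ε hε
        filter_upwards [hPΩ] with x hx
        calc _ ≤ (leftDerivMajorant P α g x + leftDerivMajorant P α g x) ^ 2 :=
              pow_le_pow_left' (enorm_sub_le.trans (add_le_add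
                (enorm_truncLeftDeriv_le hx hα₀ hα₁ hε g)
                (enorm_scaledLeftDeriv_le P hα₀ hα₁ le_rfl g x))) 2
          _ = _ := by ring
      · rw [lintegral_const_mul _ hBm]
        exact ENNReal.mul_ne_top (by norm_num) hM
      · filter_upwards [hPΩ, hB] with x hx hBx
        have hfin : marchaudMajorant P α g x ≠ ∞ := by
          have h1 : leftDerivMajorant P α g x ≠ ∞ := fun h => by simp [h] at hBx
          have h2 : ENNReal.ofReal (α / Real.Gamma (1 - α)) * marchaudMajorant P α g x ≠ ∞ :=
            fun h => h1 (by rw [leftDerivMajorant, h, top_add])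
          have hΓ : 0 < Real.Gamma (1 - α) := Real.Gamma_pos_of_pos (sub_pos.2 hα₁)
          refine (ENNReal.lt_top_of_mul_ne_top_right h2 ?_).ne
          have : 0 < α / Real.Gamma (1 - α) := by positivity
          simpa using this
        have ht := (tendsto_truncLeftDeriv hx hg hfin).sub_const (scaledLeftDeriv P α 1 g x)
        rw [sub_self] at ht
        have ht2 := (ENNReal.continuous_pow 2).continuousAt.tendsto.comp ht.enorm
        simpa [Function.comp_def] using ht2
    rw [lintegral_zero] at hlim
    refine tendsto_zero_of_sq_ennreal (hlim.congr' ?_)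
    filter_upwards [self_mem_nhdsWithin] with ε hε
    rw [eLpNorm_two_sq]
    refine lintegral_congr_ae ?_
    filter_upwards [hae] with x hx
    rw [hx ε hε]

theorem HasLeftDeriv.eLpNorm_le {Ω : Opens (E n)} {P : E n} {α : ℝ} {p : ℝ≥0∞} (hp : 1 ≤ p)
    {f g : E n → ℂ} (h : HasLeftDeriv Ω P α p f g) {M : ℝ≥0∞}
    (hM : ∀ ε : ℝ, 0 < ε →
      eLpNorm (truncLeftDeriv P α ε f) p (volume.restrict (Ω : Set (E n))) ≤ M) :
    eLpNorm g p (volume.restrict (Ω : Set (E n))) ≤ M := by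
  have hlim := h.2.2.add_const M
  rw [zero_add] at hlim
  refine ge_of_tendsto hlim ?_
  filter_upwards [self_mem_nhdsWithin] with ε hε
  have hT := h.2.1 ε hε
  have h1 := eLpNorm_sub_le hT.1 (hT.1.sub h.1.1) hp
  rw [sub_sub_cancel, add_comm] at h1
  exact h1.trans (add_le_add le_rfl (hM ε hε))

end Kipriyanov

/-! ### The embedding theorem. -/

theorem lemma1 (n : ℕ) (hn : 1 ≤ n) (α : ℝ) (hα₀ : 0 < α) (hα₁ : α < 1)
    (Ω : TopologicalSpace.Opens (Kipriyanov.E n))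
    (hΩc : Convex ℝ (Ω : Set (Kipriyanov.E n)))
    (hΩb : Bornology.IsBounded (Ω : Set (Kipriyanov.E n)))
    (P : Kipriyanov.E n) (hP : P ∈ frontier (Ω : Set (Kipriyanov.E n))) :
    ∃ K : ℝ, 0 < K ∧ ∀ f : Kipriyanov.E n → ℂ, Kipriyanov.MemH10 Ω f →
      Kipriyanov.HasLeftDeriv Ω P α 2 f (Kipriyanov.leftDeriv Ω P α 2 f) ∧
      Kipriyanov.normL2 Ω (Kipriyanov.leftDeriv Ω P α 2 f) ≤ K * Kipriyanov.normH10 Ω f := by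
  open Kipriyanov in
  have hP' := hP
  rw [Ω.isOpen.frontier_eq] at hP'
  have hPΩ : P ∉ Ω := hP'.2
  have hne : (Ω : Set (E n)).Nonempty := closure_nonempty_iff.1 ⟨P, hP'.1⟩
  obtain ⟨C, hC, hbound⟩ := exists_energy_bound hn hα₁ Ω hΩc hΩb hne hPΩ
  set a := ENNReal.ofReal (α / Real.Gamma (1 - α)) with ha
  set b := ENNReal.ofReal ((Real.Gamma (1 - α))⁻¹ + 1) with hb
  set c : ℝ≥0∞ := 2 * (a ^ 2 * C + b ^ 2 * C) with hc
  have hct : c ≠ ∞ := by finiteness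
  -- The added 1 keeps K positive even if c = 0.
  set K : ℝ := √c.toReal + 1 with hK
  have hK0 : 0 < K := by positivity
  have hcK : c ≤ ENNReal.ofReal K ^ 2 := by
    rw [← ENNReal.ofReal_toReal hct, ← ENNReal.ofReal_pow hK0.le]
    refine ENNReal.ofReal_le_ofReal ?_
    have h1 := Real.sq_sqrt (ENNReal.toReal_nonneg (a := c))
    have h2 := Real.sqrt_nonneg c.toReal
    rw [hK]
    nlinarith
  refine ⟨K, hK0, fun f hf => ?_⟩
  obtain ⟨g, hg, hfg, hrad, hmar⟩ := hf.exists_representative hC hbound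
  have hN0 : 0 ≤ normH10 Ω f := Real.sqrt_nonneg _
  have hBle : ∫⁻ x in (Ω : Set (E n)), leftDerivMajorant P α g x ^ 2 ≤
      ENNReal.ofReal (K * normH10 Ω f) ^ 2 := by
    calc _ ≤ ∫⁻ x in (Ω : Set (E n)), (2 * a ^ 2 * marchaudMajorant P α g x ^ 2 +
          2 * b ^ 2 * radialWeight P α g x ^ 2) := by
          refine lintegral_mono fun x => (add_sq_le_two_mul _ _).trans (le_of_eq ?_)
          ring
      _ = 2 * a ^ 2 * (∫⁻ x in (Ω : Set (E n)), marchaudMajorant P α g x ^ 2) +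
          2 * b ^ 2 * ∫⁻ x in (Ω : Set (E n)), radialWeight P α g x ^ 2 := by
          rw [lintegral_add_left (((measurable_marchaudMajorant P α hg).pow_const 2).const_mul _),
            lintegral_const_mul' _ _ (by finiteness), lintegral_const_mul' _ _ (by finiteness)]
      _ ≤ 2 * a ^ 2 * (C * ENNReal.ofReal (normH10 Ω f) ^ 2) +
          2 * b ^ 2 * (C * ENNReal.ofReal (normH10 Ω f) ^ 2) := by gcongr
      _ = c * ENNReal.ofReal (normH10 Ω f) ^ 2 := by rw [hc]; ring
      _ ≤ ENNReal.ofReal K ^ 2 * ENNReal.ofReal (normH10 Ω f) ^ 2 := by gcongr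
      _ = _ := by rw [ENNReal.ofReal_mul hK0.le, mul_pow]
  have hex : ∃ u, HasLeftDeriv Ω P α 2 f u := ⟨_, hasLeftDeriv_of_majorant hΩc hP hα₀ hα₁ hg hfg
    (ne_top_of_le_ne_top (by finiteness) hBle)⟩
  have hD : HasLeftDeriv Ω P α 2 f (leftDeriv Ω P α 2 f) := by
    rw [leftDeriv, dif_pos hex]
    exact hex.choose_spec
  refine ⟨hD, ?_⟩
  -- `leftDeriv` is an arbitrarily chosen limit, so its norm is bounded through the truncations
  -- rather than through the explicit formula.
  have hle := hD.eLpNorm_le (by norm_num) (M := ENNReal.ofReal (K * normH10 Ω f)) ?_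
  · have h2 : ENNReal.ofReal (normL2 Ω (leftDeriv Ω P α 2 f)) ≤
        ENNReal.ofReal (K * normH10 Ω f) := by
      refine (ENNReal.pow_le_pow_left_iff two_ne_zero).1 ?_
      rw [ofReal_normL2_sq hD.1]
      exact pow_le_pow_left' hle 2
    exact (ENNReal.ofReal_le_ofReal_iff (by positivity)).1 h2
  · intro ε hε
    refine (ENNReal.pow_le_pow_left_iff two_ne_zero).1 (le_trans ?_ hBle)
    rw [eLpNorm_two_sq]
    refine lintegral_mono_ae ?_
    filter_upwards [ae_truncLeftDeriv_eq hΩc hP α hfg,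
      ae_restrict_mem Ω.isOpen.measurableSet] with x hx hxΩ
    rw [hx ε hε]
    exact pow_le_pow_left'
      (enorm_truncLeftDeriv_le (fun h : P = x => hPΩ (h ▸ hxΩ)) hα₀ hα₁ hε g) 2
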